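/- Let $(M_n)_{n\ge 1}$ and $(N_n)_{n\ge 1}$ be sequences of integers with $M_n\ge 2$ and $1\le N_n\le M_n^2$ for all $n$, and suppose that $$s=\liminf_{n\to\infty}\frac{\sum_{i=1}^n\log N_i}{\sum_{i=1}^n\log M_i}<1 .$$ Construct random finite families $\mathcal F_n$ of closed squares as follows. Start from $\mathcal F_0=([0,1]^2)$. Given $\mathcal F_{n-1}$, divide each member $Q$ of $\mathcal F_{n-1}$ into $M_n^2$ closed squares of equal side length, and choose $N_n$ of these, each choice being uniformly distributed on the $M_n^2$ squares and all choices (within $Q$, for different members of $\mathcal F_{n-1}$, and at different levels) being independent; $\mathcal F_n$ is the family of all squares so chosen, counted with multiplicity, so that it has $P_n=\prod_{k=1}^n N_k$ members. Let $\Omega$, with probability measure $\mathbb P$, be the probability space induced by this construction. For $\omega\in\Omega$ let $$\mu_n=\sum_{Q\in\mathcal F_n}c_n\,\mathcal L|_Q,\qquad c_n=\prod_{i=1}^n M_i^2N_i^{-1},$$ where $\mathcal L|_Q$ is the Lebesgue measure on $Q$. For every $\omega$ the measures $\mu_n$ converge weakly to a probability measure $\mu=\mu(\omega)$. For a line $\ell\subset\mathbb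 R^2$ let $\pi_\ell$ be the orthogonal projection onto $\ell$, and for $x\in\ell$ and $r>0$ let $B(x,r)$ be the open ball in $\ell$ with centre $x$ and radius $r$. **Theorem.** Let $0\le t<s$. There is a constant $C_0<\infty$ (depending only on $t$ and the sequences $(M_n)$, $(N_n)$) such that, with positive probability, $$(\pi_\ell)_*\mu(B(x,r))\le C_0\,r^t\qquad\text{for all lines }\ell,\text{ all }x\in\ell\text{ and all }r>0 .$$ That is, there is a measurable set $A\subset\Omega$ with $\mathbb P(A)>0$ such that this bound holds for every $\omega\in A$. -/

import Mathlib

open MeasureTheory ProbabilityTheory Filter Topology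

namespace RandomCantor

/-- The Euclidean plane. -/
abbrev Plane : Type := EuclideanSpace ℝ (Fin 2)

/-! Throughout, the defining sequences are indexed from `0`: `M_n` and `N_n` (`n ≥ 1`) are
written `M (n - 1)` and `N (n - 1)`. -/

/-- Labels `(i₁, …, iₙ)`, `i_k ∈ {1, …, N_k}`, of the `P_n = N₁ ⋯ N_n` chosen squares of level `n`.
The squares are indexed by labels, so the same square may be chosen several times. -/
abbrev Node (N : ℕ → ℕ) (n : ℕ) : Type := (k : Fin n) → Fin (N k)

/-- The label of the parent (of level `n`) of a chosen square of level `n + 1`. -/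
def Node.parent {N : ℕ → ℕ} {n : ℕ} (v : Node N (n + 1)) : Node N n := fun k => v k.castSucc

/-- The sample space: for every label `v` of level `n + 1`, the position in `{0, …, M - 1}²` of the
square labelled `v` inside the grid of `M × M` subsquares of its parent, where `M = M n`. -/
abbrev Sample (M N : ℕ → ℕ) : Type :=
  (v : Σ n : ℕ, Node N (n + 1)) → (Fin 2 → Fin (M v.1))

/-- The law of the construction: all the choices are independent and uniformly distributed. -/
noncomputable def law (M N : ℕ → ℕ) : Measure (Sample M N) :=
  Measure.infinitePi fun v : Σ n : ℕ, Node N (n + 1) =>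
    uniformOn (Set.univ : Set (Fin 2 → Fin (M v.1)))

/-- The side length `r_n = (M₁ ⋯ M_n)⁻¹` of the squares of level `n`. -/
noncomputable def side (M : ℕ → ℕ) (n : ℕ) : ℝ := (∏ k ∈ Finset.range n, (M k : ℝ))⁻¹

/-- The lower left corner of the chosen square with a given label: it is `(0, 0)` for the unit
square, and the subsquare in position `(i, j)` of a square of level `n` has its corner shifted by
`r_{n+1} (i, j)`. -/
noncomputable def corner {M N : ℕ → ℕ} (ω : Sample M N) : (n : ℕ) → Node N n → (Fin 2 → ℝ)
  | 0, _ => 0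
  | n + 1, v => fun a => corner ω n v.parent a + side M (n + 1) * (ω ⟨n, v⟩ a : ℕ)

/-- The chosen closed square with label `v`. -/
noncomputable def square {M N : ℕ → ℕ} (ω : Sample M N) (n : ℕ) (v : Node N n) : Set Plane :=
  {x | ∀ a, x a ∈ Set.Icc (corner ω n v a) (corner ω n v a + side M n)}

/-- Squares have finite area. -/
theorem volume_square_lt_top {M N : ℕ → ℕ} (ω : Sample M N) (n : ℕ) (v : Node N n) :
    volume (square ω n v) < ⊤ := by
  have h : square ω n v = (MeasurableEquiv.toLp 2 (Fin 2 → ℝ)).symm ⁻¹'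
      (Set.univ.pi fun a => Set.Icc (corner ω n v a) (corner ω n v a + side M n)) := by
    ext x
    simp only [square, Set.mem_ofPred_eq, Set.mem_preimage, Set.mem_pi, Set.mem_univ, true_imp_iff]
    rfl
  rw [h, (EuclideanSpace.volume_preserving_symm_measurableEquiv_toLp (Fin 2)).measure_preimage
    (MeasurableSet.univ_pi fun a => measurableSet_Icc).nullMeasurableSet, volume_pi_pi]
  simp only [Real.volume_Icc]
  exact ENNReal.prod_lt_top fun _ _ => ENNReal.ofReal_lt_top

/-- Lebesgue measure restricted to a chosen square, as a finite measure. -/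
noncomputable def lebesgueOn {M N : ℕ → ℕ} (ω : Sample M N) (n : ℕ) (v : Node N n) :
    FiniteMeasure Plane :=
  ⟨volume.restrict (square ω n v), isFiniteMeasure_restrict.2 (volume_square_lt_top ω n v).ne⟩

/-- The density `c_n = ∏ M_i² N_i⁻¹`, over `1 ≤ i ≤ n`. -/
noncomputable def density (M N : ℕ → ℕ) (n : ℕ) : NNReal :=
  ∏ k ∈ Finset.range n, ((M k : NNReal) ^ 2 * (N k : NNReal)⁻¹)

/-- The measure `μ_n = ∑ c_n 𝓛|_Q`, the sum over the chosen squares `Q` of level `n`, counted with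
multiplicity. -/
noncomputable def levelMeasure {M N : ℕ → ℕ} (ω : Sample M N) (n : ℕ) : FiniteMeasure Plane :=
  ∑ v : Node N n, density M N n • lebesgueOn ω n v

/-- The natural measure `μ`: the limit of `μ_n` in the topology of weak convergence. -/
noncomputable def naturalMeasure {M N : ℕ → ℕ} (ω : Sample M N) : FiniteMeasure Plane :=
  limUnder atTop fun n => levelMeasure ω n

/-- The number `s = liminf (∑ log N_i) / (∑ log M_i)`, the sums over `1 ≤ i ≤ n`. -/
noncomputable def dimension (M N : ℕ → ℕ) : ℝ :=
  liminf (fun n : ℕ => (∑ i ∈ Finset.range n, Real.log (N i)) /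
    ∑ i ∈ Finset.range n, Real.log (M i)) atTop

end RandomCantor

/-! The measure `μ` is the image of the uniform measure on infinite label sequences under the map
sending a sequence to the common point of its nested squares. The mass of a strip of half-width `ρ`
is therefore at most the proportion of level `m` squares with corner in a slightly wider strip,
where `m` is any level with side at most `ρ`.

For a fixed strip this proportion is the last term of a martingale: at level `n`, replace the
indicator `φ` by its mean over all level `m` grid corners below a given square (`levelMean`), and
average over the chosen squares (`cornerMean`). Given level `n`, the choices of the next step are
independent, and one square contributes at most `P_n⁻¹ min(1, 25ρ/r_n)`. Since `P_n⁻¹ ≤ K r_n ^ t₁`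
for `t₁ < s`, and `min(1, x) ≤ x ^ t` for `0 ≤ t ≤ 1`, this is at most a constant times `ρ ^ t q ^
n` with `q < 1` as soon as `t < t₁`. These bounds are summable, so an exponential moment with
parameter of order `ρ ^ (-t)` survives all steps with the loss of a factor `e` only
(`lintegral_exp_cornerMean_le`). Markov's inequality gives `exists_tail_bound`.

At scale `2⁻ʲ` it suffices to control `O(8ʲ)` strips. Applying the tail bound with an exponent
slightly above `t` makes each failure probability superexponentially small in a power of `2ʲ`. The
sum over all scales beyond some `j₀` is less than `1`, and on the complementary event the bound
holds for all lines at once. -/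

namespace RandomCantor

variable {M N : ℕ → ℕ}

/-! ### Side lengths and nested corners. -/

theorem side_pos (hM : ∀ n, 2 ≤ M n) (n : ℕ) : 0 < side M n :=
  inv_pos.2 (Finset.prod_pos fun k _ => by exact_mod_cast (zero_lt_two.trans_le (hM k)))

theorem side_succ (hM : ∀ n, 2 ≤ M n) (n : ℕ) : (M n : ℝ) * side M (n + 1) = side M n := by
  have h : (M n : ℝ) ≠ 0 := by exact_mod_cast (zero_lt_two.trans_le (hM n)).ne'
  rw [side, side, Finset.prod_range_succ, mul_inv, mul_comm, mul_assoc, inv_mul_cancel₀ h, mul_one]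

theorem side_succ_le (hM : ∀ n, 2 ≤ M n) (n : ℕ) : side M (n + 1) ≤ side M n / 2 := by
  have h : (2 : ℝ) ≤ M n := by exact_mod_cast hM n
  have := side_succ hM n
  nlinarith [side_pos hM (n + 1)]

theorem side_le_pow (hM : ∀ n, 2 ≤ M n) (n : ℕ) : side M n ≤ (1 / 2) ^ n := by
  induction n with
  | zero => simp [side]
  | succ n ih =>
    have := side_succ_le hM n
    rw [pow_succ]
    linarith

theorem tendsto_side (hM : ∀ n, 2 ≤ M n) : Tendsto (side M) atTop (𝓝 0) :=
  squeeze_zero (fun n => (side_pos hM n).le) (side_le_pow hM)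
    (tendsto_pow_atTop_nhds_zero_of_lt_one (by norm_num) (by norm_num))

theorem exists_side_le (hM : ∀ n, 2 ≤ M n) {ρ : ℝ} (hρ : 0 < ρ) : ∃ n, side M n ≤ ρ :=
  ((tendsto_side hM).eventually (ge_mem_nhds hρ)).exists

/-- The label of level `n` below an infinite branch. -/
def branch (y : (k : ℕ) → Fin (N k)) (n : ℕ) : Node N n := fun k => y k

theorem corner_succ (ω : Sample M N) (n : ℕ) (v : Node N (n + 1)) (a : Fin 2) :
    corner ω (n + 1) v a = corner ω n v.parent a + side M (n + 1) * (ω ⟨n, v⟩ a : ℕ) := rfl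

theorem corner_branch_mono (hM : ∀ n, 2 ≤ M n) (ω : Sample M N) (y : (k : ℕ) → Fin (N k))
    (a : Fin 2) : Monotone fun n => corner ω n (branch y n) a :=
  monotone_nat_of_le_succ fun n => by
    rw [corner_succ]
    exact le_add_of_nonneg_right (mul_nonneg (side_pos hM _).le (Nat.cast_nonneg _))

theorem corner_branch_add_side_anti (hM : ∀ n, 2 ≤ M n) (ω : Sample M N)
    (y : (k : ℕ) → Fin (N k)) (a : Fin 2) :
    Antitone fun n => corner ω n (branch y n) a + side M n :=
  antitone_nat_of_succ_le fun n => by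
    rw [corner_succ]
    have h : ((ω ⟨n, branch y (n + 1)⟩ a : ℕ) : ℝ) + 1 ≤ M n := by
      exact_mod_cast (ω ⟨n, branch y (n + 1)⟩ a).2
    have h2 := side_succ hM n
    have h3 := side_pos hM (n + 1)
    have : (branch y (n + 1)).parent = branch y n := rfl
    rw [this]
    nlinarith

theorem corner_nonneg (hM : ∀ n, 2 ≤ M n) (ω : Sample M N) (n : ℕ) (v : Node N n) (a : Fin 2) :
    0 ≤ corner ω n v a := by
  induction n with
  | zero => exact le_rfl
  | succ n ih =>
    rw [corner_succ]
    exact add_nonneg (ih _) (mul_nonneg (side_pos hM _).le (Nat.cast_nonneg _))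

theorem corner_add_side_le (hM : ∀ n, 2 ≤ M n) (ω : Sample M N) (n : ℕ) (v : Node N n)
    (a : Fin 2) : corner ω n v a + side M n ≤ 1 := by
  induction n with
  | zero => simp [corner, side]
  | succ n ih =>
    rw [corner_succ]
    have h : ((ω ⟨n, v⟩ a : ℕ) : ℝ) + 1 ≤ M n := by exact_mod_cast (ω ⟨n, v⟩ a).2
    have h2 := side_succ hM n
    have h3 := side_pos hM (n + 1)
    have := ih v.parent
    nlinarith

/-! ### The natural measure as an image of the uniform measure on branches. -/

/-- The point of the limit set below an infinite branch. -/
noncomputable def limitPoint (ω : Sample M N) (y : (k : ℕ) → Fin (N k)) : Plane :=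
  WithLp.toLp 2 fun a => ⨆ n, corner ω n (branch y n) a

theorem tendsto_corner_branch (hM : ∀ n, 2 ≤ M n) (ω : Sample M N) (y : (k : ℕ) → Fin (N k))
    (a : Fin 2) : Tendsto (fun n => corner ω n (branch y n) a) atTop (𝓝 (limitPoint ω y a)) :=
  tendsto_atTop_ciSup (corner_branch_mono hM ω y a) ⟨1, by
    rintro _ ⟨n, rfl⟩
    have := corner_add_side_le hM ω n (branch y n) a
    have := side_pos hM n
    dsimp only
    linarith⟩

theorem limitPoint_mem_square (hM : ∀ n, 2 ≤ M n) (ω : Sample M N) (y : (k : ℕ) → Fin (N k))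
    (n : ℕ) : limitPoint ω y ∈ square ω n (branch y n) := fun a => by
  have h := tendsto_corner_branch hM ω y a
  refine ⟨(corner_branch_mono hM ω y a).ge_of_tendsto h n, ?_⟩
  have h2 : Tendsto (fun n => corner ω n (branch y n) a + side M n) atTop
      (𝓝 (limitPoint ω y a)) := by simpa using h.add (tendsto_side hM)
  exact (corner_branch_add_side_anti hM ω y a).le_of_tendsto h2 n

theorem measurable_limitPoint (hM : ∀ n, 2 ≤ M n) (ω : Sample M N) :
    Measurable (limitPoint ω) := by
  have h : Measurable fun y a => limitPoint ω y a := by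
    refine measurable_pi_lambda _ fun a => ?_
    refine measurable_of_tendsto_metrizable (fun n => ?_)
      (tendsto_pi_nhds.2 fun y => tendsto_corner_branch hM ω y a)
    have hb : Measurable fun y : (k : ℕ) → Fin (N k) => branch y n :=
      measurable_pi_lambda _ fun k => measurable_pi_apply _
    exact (measurable_of_countable fun v : Node N n => corner ω n v a).comp hb
  exact (MeasurableEquiv.toLp 2 (Fin 2 → ℝ)).measurable.comp h

/-- The uniform measure on the infinite branches. -/
noncomputable def branchMeasure (N : ℕ → ℕ) : Measure ((k : ℕ) → Fin (N k)) :=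
  Measure.infinitePi fun k => uniformOn (Set.univ : Set (Fin (N k)))

theorem isProbabilityMeasure_uniformOn_univ {α : Type*} [Fintype α] [Nonempty α]
    [MeasurableSpace α] [MeasurableSingletonClass α] :
    IsProbabilityMeasure (uniformOn (Set.univ : Set α)) :=
  isProbabilityMeasure_uniformOn Set.finite_univ Set.univ_nonempty

/-- The number `P_n` of chosen squares of level `n`. -/
noncomputable def count (N : ℕ → ℕ) (n : ℕ) : ℝ := ∏ k ∈ Finset.range n, (N k : ℝ)

theorem count_pos (hN : ∀ n, 1 ≤ N n) (n : ℕ) : 0 < count N n :=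
  Finset.prod_pos fun k _ => by exact_mod_cast hN k

theorem isProbabilityMeasure_uniformOn_fin (hN : ∀ n, 1 ≤ N n) (k : ℕ) :
    IsProbabilityMeasure (uniformOn (Set.univ : Set (Fin (N k)))) :=
  have : Nonempty (Fin (N k)) := ⟨⟨0, hN k⟩⟩
  isProbabilityMeasure_uniformOn_univ

theorem isProbabilityMeasure_branchMeasure (hN : ∀ n, 1 ≤ N n) :
    IsProbabilityMeasure (branchMeasure N) :=
  have := isProbabilityMeasure_uniformOn_fin hN
  inferInstanceAs (IsProbabilityMeasure (Measure.infinitePi _))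

theorem measurable_branch (n : ℕ) :
    Measurable fun y : (k : ℕ) → Fin (N k) => branch y n :=
  measurable_pi_lambda _ fun _ => measurable_pi_apply _

theorem uniformOn_univ_singleton {α : Type*} [Fintype α] [MeasurableSpace α]
    [MeasurableSingletonClass α] (x : α) :
    uniformOn (Set.univ : Set α) {x} = (Fintype.card α : ENNReal)⁻¹ := by
  rw [uniformOn_univ, Measure.count_singleton, one_div]

theorem map_branch_singleton (hN : ∀ n, 1 ≤ N n) (n : ℕ) (v : Node N n) :
    (branchMeasure N).map (fun y => branch y n) {v} = ENNReal.ofReal (count N n)⁻¹ := by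
  have := isProbabilityMeasure_uniformOn_fin hN
  have h : (branchMeasure N).map (fun y => branch y n) =
      Measure.infinitePi fun k : Fin n => uniformOn (Set.univ : Set (Fin (N k))) :=
    Measure.map_infinitePi_infinitePi_of_inj
      (P := fun k => uniformOn (Set.univ : Set (Fin (N k)))) Fin.val_injective
  rw [h, Measure.infinitePi_singleton_of_fintype]
  simp only [uniformOn_univ_singleton, Fintype.card_fin]
  rw [ENNReal.ofReal_inv_of_pos (count_pos hN n), count,
    ENNReal.ofReal_prod_of_nonneg fun _ _ => Nat.cast_nonneg _, Finset.prod_range,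
    ← ENNReal.prod_inv_distrib]
  · simp
  · intro i _ j _ _
    simp

theorem integral_branch (hN : ∀ n, 1 ≤ N n) (n : ℕ) (F : Node N n → ℝ) :
    ∫ y, F (branch y n) ∂branchMeasure N = (count N n)⁻¹ * ∑ v, F v := by
  have := isProbabilityMeasure_branchMeasure hN
  have : IsProbabilityMeasure ((branchMeasure N).map (fun y => branch y n)) :=
    Measure.isProbabilityMeasure_map (measurable_branch n).aemeasurable
  rw [← integral_map (φ := fun y => branch y n) (f := F) (measurable_branch n).aemeasurable
    (measurable_of_countable F).aestronglyMeasurable,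
    integral_fintype .of_finite, Finset.mul_sum]
  refine Finset.sum_congr rfl fun v _ => ?_
  rw [measureReal_def, map_branch_singleton hN,
    ENNReal.toReal_ofReal (inv_pos.2 (count_pos hN n)).le, smul_eq_mul]

theorem square_eq_preimage (ω : Sample M N) (n : ℕ) (v : Node N n) :
    square ω n v = (MeasurableEquiv.toLp 2 (Fin 2 → ℝ)).symm ⁻¹'
      (Set.univ.pi fun a => Set.Icc (corner ω n v a) (corner ω n v a + side M n)) := by
  ext x
  simp only [square, Set.mem_ofPred_eq, Set.mem_preimage, Set.mem_pi, Set.mem_univ, true_imp_iff]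
  rfl

theorem volume_real_square (hM : ∀ n, 2 ≤ M n) (ω : Sample M N) (n : ℕ) (v : Node N n) :
    volume.real (square ω n v) = side M n ^ 2 := by
  rw [square_eq_preimage, measureReal_def,
    (EuclideanSpace.volume_preserving_symm_measurableEquiv_toLp (Fin 2)).measure_preimage
    (MeasurableSet.univ_pi fun a => measurableSet_Icc).nullMeasurableSet, volume_pi_pi]
  simp [Real.volume_Icc, (side_pos hM n).le, pow_two]

theorem dist_le_of_mem_square {ω : Sample M N} {n : ℕ} {v : Node N n} {x y : Plane}
    (hx : x ∈ square ω n v) (hy : y ∈ square ω n v) : dist x y ≤ 2 * side M n := by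
  have h (a : Fin 2) : |x a - y a| ≤ side M n := by
    have h1 := hx a
    have h2 := hy a
    rw [Set.mem_Icc] at h1 h2
    rw [abs_le]
    constructor <;> linarith
  have h0 : 0 ≤ side M n := (abs_nonneg _).trans (h 0)
  rw [EuclideanSpace.dist_eq]
  refine Real.sqrt_le_iff.2 ⟨by positivity, ?_⟩
  rw [Fin.sum_univ_two, Real.dist_eq, Real.dist_eq]
  nlinarith [pow_le_pow_left₀ (abs_nonneg _) (h 0) 2, pow_le_pow_left₀ (abs_nonneg _) (h 1) 2,
    sq_nonneg (side M n)]

theorem density_eq (n : ℕ) :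
    (density M N n : ℝ) = (count N n)⁻¹ * (side M n ^ 2)⁻¹ := by
  simp only [density, count, side, NNReal.coe_prod, NNReal.coe_mul, NNReal.coe_pow,
    NNReal.coe_natCast, NNReal.coe_inv, Finset.prod_mul_distrib, Finset.prod_inv_distrib,
    Finset.prod_pow, inv_pow, inv_inv]
  ring

theorem integrable_boundedContinuous_square (ω : Sample M N) (n : ℕ) (v : Node N n)
    (f : BoundedContinuousFunction Plane ℝ) : IntegrableOn f (square ω n v) :=
  have : IsFiniteMeasure (volume.restrict (square ω n v)) :=
    isFiniteMeasure_restrict.2 (volume_square_lt_top ω n v).ne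
  f.integrable _

theorem integral_levelMeasure (hM : ∀ n, 2 ≤ M n) (hN : ∀ n, 1 ≤ N n) (ω : Sample M N) (n : ℕ)
    (f : BoundedContinuousFunction Plane ℝ) :
    ∫ x, f x ∂(levelMeasure ω n : Measure Plane) =
      ∫ y, (⨍ x in square ω n (branch y n), f x) ∂branchMeasure N := by
  rw [integral_branch hN n fun v => ⨍ x in square ω n v, f x]
  have h : (levelMeasure ω n : Measure Plane) =
      ∑ v : Node N n, (density M N n) • (volume.restrict (square ω n v)) := by
    rw [levelMeasure, FiniteMeasure.toMeasure_sum]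
    rfl
  rw [h, integral_finsetSum_measure, Finset.mul_sum]
  · refine Finset.sum_congr rfl fun v _ => ?_
    rw [integral_smul_nnreal_measure, setAverage_eq, volume_real_square hM, NNReal.smul_def,
      density_eq, smul_eq_mul, smul_eq_mul, mul_assoc]
  · exact fun v _ => (integrable_boundedContinuous_square ω n v f).smul_measure_nnreal

theorem norm_setAverage_sub_le {ω : Sample M N} (hM : ∀ n, 2 ≤ M n) {n : ℕ} {v : Node N n}
    (f : BoundedContinuousFunction Plane ℝ) {c ε : ℝ} (h : ∀ x ∈ square ω n v, |f x - c| ≤ ε) :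
    |(⨍ x in square ω n v, f x) - c| ≤ ε := by
  have hpos : 0 < volume.real (square ω n v) := by
    rw [volume_real_square hM]; exact pow_pos (side_pos hM n) 2
  have h1 : (⨍ x in square ω n v, f x) - c =
      (volume.real (square ω n v))⁻¹ * ∫ x in square ω n v, (f x - c) := by
    rw [integral_sub (integrable_boundedContinuous_square ω n v f)
      (integrableOn_const (volume_square_lt_top ω n v).ne), setIntegral_const, setAverage_eq,
      smul_eq_mul, smul_eq_mul, mul_sub, ← mul_assoc, inv_mul_cancel₀ hpos.ne', one_mul]
  have h2 := norm_setIntegral_le_of_norm_le_const (μ := volume) (f := fun x => f x - c)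
    (volume_square_lt_top ω n v) h
  rw [h1, abs_mul, abs_of_pos (inv_pos.2 hpos), inv_mul_le_iff₀ hpos, mul_comm]
  exact h2

/-- Integrating `f` against `μ_n` is averaging `f` over the level `n` square of a random branch.
These squares shrink to the limit point, so dominated convergence applies. -/
theorem tendsto_levelMeasure (hM : ∀ n, 2 ≤ M n) (hN : ∀ n, 1 ≤ N n) (ω : Sample M N)
    (μ : FiniteMeasure Plane) (hμ : (μ : Measure Plane) = (branchMeasure N).map (limitPoint ω)) :
    Tendsto (fun n => levelMeasure ω n) atTop (𝓝 μ) := by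
  have := isProbabilityMeasure_branchMeasure hN
  rw [FiniteMeasure.tendsto_iff_forall_integral_tendsto]
  intro f
  simp_rw [integral_levelMeasure hM hN]
  rw [hμ, integral_map (measurable_limitPoint hM ω).aemeasurable
    f.continuous.aestronglyMeasurable]
  refine tendsto_integral_of_dominated_convergence (fun _ => ‖f‖) (fun n => ?_)
    (integrable_const _) (fun n => ?_) ?_
  · exact ((measurable_of_countable fun v : Node N n => ⨍ x in square ω n v, f x).comp
      (measurable_branch n)).aestronglyMeasurable
  · refine ae_of_all _ fun y => ?_
    have := norm_setAverage_sub_le hM (ω := ω) (v := branch y n) f (c := 0) (ε := ‖f‖)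
      fun x _ => by simpa using f.norm_coe_le_norm x
    simpa using this
  · refine ae_of_all _ fun y => Metric.tendsto_atTop.2 fun ε hε => ?_
    obtain ⟨δ, hδ, h⟩ := Metric.continuous_iff.1 f.continuous (limitPoint ω y) (ε / 2) (half_pos hε)
    obtain ⟨n₀, hn₀⟩ := eventually_atTop.1 ((tendsto_side hM).eventually (gt_mem_nhds (half_pos hδ)))
    refine ⟨n₀, fun n hn => ?_⟩
    rw [Real.dist_eq]
    refine (norm_setAverage_sub_le hM f fun x hx => ?_).trans_lt (half_lt_self hε)
    have h1 := dist_le_of_mem_square hx (limitPoint_mem_square hM ω y n)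
    have h2 := hn₀ n hn
    exact (h x (by linarith)).le

theorem naturalMeasure_eq (hM : ∀ n, 2 ≤ M n) (hN : ∀ n, 1 ≤ N n) (ω : Sample M N) :
    (naturalMeasure ω : Measure Plane) = (branchMeasure N).map (limitPoint ω) ∧
      Tendsto (fun n => levelMeasure ω n) atTop (𝓝 (naturalMeasure ω)) := by
  have := isProbabilityMeasure_branchMeasure hN
  have h := tendsto_levelMeasure hM hN ω ⟨(branchMeasure N).map (limitPoint ω), inferInstance⟩ rfl
  have h2 : naturalMeasure ω = ⟨(branchMeasure N).map (limitPoint ω), inferInstance⟩ :=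
    h.limUnder_eq
  exact ⟨by rw [h2]; rfl, h2 ▸ h⟩

/-- The mass of a set is at most the proportion of squares of level `n` whose corners satisfy a
condition which the squares meeting the set satisfy. -/
theorem naturalMeasure_le (hM : ∀ n, 2 ≤ M n) (hN : ∀ n, 1 ≤ N n) (ω : Sample M N) (n : ℕ)
    {S : Set Plane} (hS : MeasurableSet S) (E : Set (Fin 2 → ℝ))
    (h : ∀ v, ∀ x ∈ square ω n v, x ∈ S → corner ω n v ∈ E) :
    (naturalMeasure ω : Measure Plane) S ≤
      ENNReal.ofReal ((count N n)⁻¹ * ∑ v : Node N n, E.indicator 1 (corner ω n v)) := by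
  have := isProbabilityMeasure_branchMeasure hN
  rw [(naturalMeasure_eq hM hN ω).1, Measure.map_apply (measurable_limitPoint hM ω) hS,
    ← integral_branch hN n fun v => E.indicator (1 : (Fin 2 → ℝ) → ℝ) (corner ω n v)]
  have hE : MeasurableSet {y : (k : ℕ) → Fin (N k) | corner ω n (branch y n) ∈ E} :=
    measurable_branch n (Set.to_countable {v : Node N n | corner ω n v ∈ E}).measurableSet
  have h1 : (fun y : (k : ℕ) → Fin (N k) =>
      E.indicator (1 : (Fin 2 → ℝ) → ℝ) (corner ω n (branch y n))) =
      {y | corner ω n (branch y n) ∈ E}.indicator 1 := rfl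
  rw [h1, integral_indicator_one hE, ofReal_measureReal]
  exact measure_mono fun y hy => h _ _ (limitPoint_mem_square hM ω y n) hy

/-! ### Grid means of indicators of strips. -/

/-- The mean of `φ` over the `R × R` grid of mesh `δ` whose lower left corner is `p`. -/
noncomputable def gridMean (φ : (Fin 2 → ℝ) → ℝ) (R : ℕ) (δ : ℝ) (p : Fin 2 → ℝ) : ℝ :=
  ((R : ℝ) ^ 2)⁻¹ * ∑ d : Fin 2 → Fin R, φ fun a => p a + δ * (d a : ℕ)

theorem gridMean_one (φ : (Fin 2 → ℝ) → ℝ) (δ : ℝ) (p : Fin 2 → ℝ) :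
    gridMean φ 1 δ p = φ p := by
  simp [gridMean]

/-- A fine grid is a coarse grid of fine blocks: each coordinate is written in base `R`. This is the
source of the martingale property. -/
theorem gridMean_mul (φ : (Fin 2 → ℝ) → ℝ) (m R : ℕ) (δ : ℝ) (p : Fin 2 → ℝ) :
    gridMean φ (m * R) δ p = ((m : ℝ) ^ 2)⁻¹ * ∑ d : Fin 2 → Fin m,
      gridMean φ R δ (fun a => p a + δ * R * (d a : ℕ)) := by
  simp only [gridMean]
  rw [← Finset.mul_sum, ← mul_assoc, Nat.cast_mul, mul_pow, mul_inv, ← Fintype.sum_prod_type']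
  congr 1
  refine (Fintype.sum_equiv ((Equiv.arrowProdEquivProdArrow (Fin 2) (fun _ => Fin m)
    (fun _ => Fin R)).symm.trans (Equiv.piCongrRight fun _ => finProdFinEquiv)) _ _ fun d => ?_).symm
  congr 1
  funext a
  simp [Equiv.arrowProdEquivProdArrow]
  ring

theorem gridMean_nonneg {φ : (Fin 2 → ℝ) → ℝ} (h : ∀ p, 0 ≤ φ p) (R : ℕ) (δ : ℝ)
    (p : Fin 2 → ℝ) : 0 ≤ gridMean φ R δ p :=
  mul_nonneg (by positivity) (Finset.sum_nonneg fun _ _ => h _)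

/-- The corners `p` with `|⟨u, p⟩ - a| ≤ ρ`. -/
def strip (u : Fin 2 → ℝ) (a ρ : ℝ) : Set (Fin 2 → ℝ) :=
  {p | |u 0 * p 0 + u 1 * p 1 - a| ≤ ρ}

theorem card_le_of_abs_sub_le {α : Type*} (s : Finset α) (f : α → ℕ) (hf : Set.InjOn f s) {L : ℝ}
    (hL : 0 ≤ L) (h : ∀ x ∈ s, ∀ y ∈ s, (f x : ℝ) - f y ≤ L) : (s.card : ℝ) ≤ L + 1 := by
  rcases s.eq_empty_or_nonempty with rfl | hs
  · simp; linarith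
  obtain ⟨x, hx, hmin⟩ := s.exists_min_image f hs
  obtain ⟨y, hy, hmax⟩ := s.exists_max_image f hs
  have h1 : s.card ≤ f y + 1 - f x := by
    rw [← Finset.card_image_of_injOn hf, ← Nat.card_Icc]
    refine Finset.card_le_card fun k hk => ?_
    obtain ⟨z, hz, rfl⟩ := Finset.mem_image.1 hk
    exact Finset.mem_Icc.2 ⟨hmin z hz, hmax z hz⟩
  have h2 : f x ≤ f y := hmin y hy
  have h3 : (s.card : ℝ) + f x ≤ f y + 1 := by
    exact_mod_cast (by omega : s.card + f x ≤ f y + 1)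
  linarith [h y hy x hx]

-- With the other coordinate fixed, coordinate `b` of a grid point in the strip is confined to an
-- interval of length `2ρ / |u b| ≤ 4ρ`.
open scoped Classical in
theorem card_grid_strip_le {u : Fin 2 → ℝ} {b : Fin 2} (hu : 1 / 2 ≤ |u b|) (R : ℕ) {δ ρ : ℝ}
    (hδ : 0 < δ) (hρ : 0 ≤ ρ) (a : ℝ) (p : Fin 2 → ℝ) :
    ((Finset.univ.filter fun d : Fin 2 → Fin R =>
      (fun c => p c + δ * (d c : ℕ)) ∈ strip u a ρ).card : ℝ) ≤ R * (4 * ρ / δ + 1) := by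
  set T := Finset.univ.filter fun d : Fin 2 → Fin R =>
      (fun c => p c + δ * (d c : ℕ)) ∈ strip u a ρ with hT
  have hfib (e : Fin R) :
      ((T.filter fun d => d (1 - b) = e).card : ℝ) ≤ 4 * ρ / δ + 1 := by
    have hmem : ∀ d ∈ T.filter (fun d => d (1 - b) = e), d (1 - b) = e ∧
        |u b * (p b + δ * (d b : ℕ)) + (u (1 - b) * (p (1 - b) + δ * (e : ℕ)) - a)| ≤ ρ := by
      intro d hd
      obtain ⟨hd, he⟩ := Finset.mem_filter.1 hd
      refine ⟨he, le_of_eq_of_le ?_ (Finset.mem_filter.1 hd).2⟩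
      rw [← he]
      congr 1
      fin_cases b
      · simp; ring
      · simp; ring
    refine card_le_of_abs_sub_le _ (fun d => (d b : ℕ)) ?_ (by positivity) ?_
    · intro d hd d' hd' h
      have h1 := (hmem d hd).1
      have h2 := (hmem d' hd').1
      have h3 : d b = d' b := Fin.ext h
      funext c
      fin_cases b <;> fin_cases c <;> simp_all
    · intro d hd d' hd'
      have h1 := (hmem d hd).2
      have h2 := (hmem d' hd').2
      have h3 : |u b * (δ * ((d b : ℕ) - (d' b : ℕ)))| ≤ 2 * ρ := by
        rw [abs_le] at h1 h2 ⊢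
        constructor <;> linarith [h1.1, h1.2, h2.1, h2.2]
      rw [abs_mul, abs_mul, abs_of_pos hδ] at h3
      have h4 : 1 / 2 * (δ * |((d b : ℕ) : ℝ) - (d' b : ℕ)|) ≤ 2 * ρ :=
        (mul_le_mul_of_nonneg_right hu (by positivity)).trans h3
      refine (le_abs_self _).trans ?_
      rw [le_div_iff₀ hδ]
      linarith
  rw [Finset.card_eq_sum_card_fiberwise (f := fun d => d (1 - b)) (t := Finset.univ)
    fun _ _ => Finset.mem_coe.2 (Finset.mem_univ _)]
  push_cast
  refine (Finset.sum_le_sum fun e _ => hfib e).trans_eq ?_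
  rw [Finset.sum_const, Finset.card_univ, Fintype.card_fin, nsmul_eq_mul]

theorem gridMean_strip_le {u : Fin 2 → ℝ} {b : Fin 2} (hu : 1 / 2 ≤ |u b|) {R : ℕ} (hR : 0 < R)
    {δ ρ : ℝ} (hδ : 0 < δ) (hρ : 0 ≤ ρ) (a : ℝ) (p : Fin 2 → ℝ) :
    gridMean ((strip u a ρ).indicator 1) R δ p ≤ (4 * ρ / δ + 1) / R := by
  classical
  have hR' : (0 : ℝ) < R := by exact_mod_cast hR
  have h := card_grid_strip_le hu R hδ hρ a p
  rw [gridMean, inv_mul_le_iff₀ (by positivity)]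
  simp only [Set.indicator_apply, Pi.one_apply, Finset.sum_boole]
  refine h.trans_eq ?_
  field_simp

theorem gridMean_le_one {φ : (Fin 2 → ℝ) → ℝ} (h : ∀ p, φ p ≤ 1) (R : ℕ) (δ : ℝ)
    (p : Fin 2 → ℝ) : gridMean φ R δ p ≤ 1 := by
  have h1 : ∑ d : Fin 2 → Fin R, φ (fun a => p a + δ * (d a : ℕ)) ≤ (R : ℝ) ^ 2 :=
    (Finset.sum_le_sum fun d _ => h _).trans_eq (by simp)
  rcases R.eq_zero_or_pos with rfl | hR
  · simp [gridMean]
  · have hR' : (0 : ℝ) < R := by exact_mod_cast hR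
    rw [gridMean, inv_mul_le_iff₀ (by positivity), mul_one]
    exact h1

/-- The mean of `φ` over the corners of the squares of level `m` in the square of level `n` with
corner `p`. -/
noncomputable def levelMean (M : ℕ → ℕ) (φ : (Fin 2 → ℝ) → ℝ) (m n : ℕ) : (Fin 2 → ℝ) → ℝ :=
  gridMean φ (∏ k ∈ Finset.Ico n m, M k) (side M m)

theorem side_mul_prod_Ico (hM : ∀ n, 2 ≤ M n) {n m : ℕ} (h : n ≤ m) :
    side M m * (∏ k ∈ Finset.Ico n m, M k : ℕ) = side M n := by
  induction m, h using Nat.le_induction with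
  | base => simp
  | succ m h ih =>
    rw [Finset.prod_Ico_succ_top h, Nat.cast_mul, ← ih, ← side_succ hM m]
    ring

theorem levelMean_self (φ : (Fin 2 → ℝ) → ℝ) (m : ℕ) : levelMean M φ m m = φ := by
  funext p
  rw [levelMean, Finset.Ico_self, Finset.prod_empty, gridMean_one]

/-- The martingale identity: the mean below a square is the average of the means below a uniformly
chosen subsquare. -/
theorem levelMean_eq (hM : ∀ n, 2 ≤ M n) (φ : (Fin 2 → ℝ) → ℝ) {n m : ℕ} (h : n < m)
    (p : Fin 2 → ℝ) : levelMean M φ m n p = ((M n : ℝ) ^ 2)⁻¹ * ∑ d : Fin 2 → Fin (M n),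
      levelMean M φ m (n + 1) (fun a => p a + side M (n + 1) * (d a : ℕ)) := by
  rw [levelMean, Finset.prod_eq_prod_Ico_succ_bot h, gridMean_mul, side_mul_prod_Ico hM h]
  rfl

theorem levelMean_strip_le (hM : ∀ n, 2 ≤ M n) {u : Fin 2 → ℝ} {b : Fin 2} (hu : 1 / 2 ≤ |u b|)
    {n m : ℕ} (h : n ≤ m) {ρ : ℝ} (hρ : side M m ≤ ρ) (a : ℝ) (p : Fin 2 → ℝ) :
    levelMean M ((strip u a (6 * ρ)).indicator 1) m n p ≤ 25 * ρ / side M n := by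
  have hm := side_pos hM m
  have hn := side_pos hM n
  have hR : 0 < ∏ k ∈ Finset.Ico n m, M k :=
    Finset.prod_pos fun k _ => zero_lt_two.trans_le (hM k)
  refine (gridMean_strip_le hu hR hm (by linarith) a p).trans ?_
  have hR' : (0 : ℝ) < (∏ k ∈ Finset.Ico n m, M k : ℕ) := by exact_mod_cast hR
  rw [← side_mul_prod_Ico hM h, div_le_div_iff₀ hR' (by positivity)]
  -- The constant is `25 = 4 * 6 + 1`; the `1` is absorbed because the mesh is at most `ρ`.
  have h1 : (4 * (6 * ρ) / side M m + 1) * side M m ≤ 25 * ρ := by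
    rw [add_mul, div_mul_cancel₀ _ hm.ne']
    linarith
  nlinarith

/-! ### Independence and measurability of the choices. -/

/-- Conditional independence of a product over coordinates in `T`, given the coordinates in `S`. -/
theorem lintegral_infinitePi_prod {ι : Type*} {X : ι → Type*} [∀ i, MeasurableSpace (X i)]
    [∀ i, Countable (X i)] [∀ i, MeasurableSingletonClass (X i)] (μ : ∀ i, Measure (X i))
    [∀ i, IsProbabilityMeasure (μ i)] {S T : Finset ι} (hST : Disjoint S T)
    (g : ∀ i, X i → (∀ i : S, X i) → ENNReal) :
    ∫⁻ ω, ∏ i ∈ T, g i (ω i) (S.restrict ω) ∂Measure.infinitePi μ =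
      ∫⁻ ω, ∏ i ∈ T, (∫⁻ x, g i x (S.restrict ω) ∂μ i) ∂Measure.infinitePi μ := by
  have hind : iIndepFun (fun i (ω : ∀ i, X i) => ω i) (Measure.infinitePi μ) :=
    iIndepFun_infinitePi (X := fun _ x => x) fun _ => measurable_id
  have hres (S : Finset ι) : Measurable fun (ω : ∀ i, X i) (i : S) => ω i :=
    Finset.measurable_restrict S
  have hpair := (hind.indepFun_finset S T hST fun i => measurable_pi_apply i).map_prod_eq_prod_map_map
    (hres S).aemeasurable (hres T).aemeasurable
  set F : (∀ i : S, X i) × (∀ i : T, X i) → ENNReal := fun q => ∏ i : T, g i (q.2 i) q.1 with hF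
  have hmeas : Measurable F := measurable_of_countable _
  have h1 : ∀ ω : ∀ i, X i, ∏ i ∈ T, g i (ω i) (S.restrict ω) =
      F (fun i : S => ω i, fun i : T => ω i) := fun ω =>
    (Finset.prod_coe_sort T fun i => g i (ω i) (S.restrict ω)).symm
  simp_rw [h1]
  have : IsProbabilityMeasure ((Measure.infinitePi μ).map fun ω (i : T) => ω i) :=
    Measure.isProbabilityMeasure_map (Finset.measurable_restrict T).aemeasurable
  rw [← lintegral_map hmeas (by fun_prop : Measurable fun ω : ∀ i, X i =>
      ((fun i : S => ω i, fun i : T => ω i) : (∀ i : S, X i) × (∀ i : T, X i))), hpair,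
    lintegral_prod _ hmeas.aemeasurable, lintegral_map (measurable_of_countable _) (by fun_prop)]
  refine lintegral_congr fun ω => ?_
  rw [lintegral_map (measurable_of_countable _) (by fun_prop)]
  have h2 : ∀ ω' : ∀ i, X i, F (fun i : S => ω i, fun i : T => ω' i) =
      ∏ i ∈ T, g i (ω' i) (S.restrict ω) := fun ω' =>
    Finset.prod_coe_sort T fun i => g i (ω' i) (S.restrict ω)
  simp_rw [h2]
  rw [lintegral_prod_eq_prod_lintegral_of_indepFun T
    (fun i (ω' : ∀ i, X i) => g i (ω' i) (S.restrict ω))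
    (iIndepFun_infinitePi (X := fun i x => g i x (S.restrict ω)) fun _ => measurable_of_countable _)
    fun i => (measurable_of_countable fun x => g i x (S.restrict ω)).comp (measurable_pi_apply i)]
  refine Finset.prod_congr rfl fun i _ => ?_
  rw [← lintegral_map (f := fun x => g i x (S.restrict ω)) (measurable_of_countable _)
    (measurable_pi_apply i), Measure.infinitePi_map_eval]

theorem corner_congr {ω ω' : Sample M N} {n : ℕ}
    (h : ∀ k < n, ∀ w : Node N (k + 1), ω ⟨k, w⟩ = ω' ⟨k, w⟩) (v : Node N n) :
    corner ω n v = corner ω' n v := by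
  induction n with
  | zero => rfl
  | succ n ih =>
    funext a
    rw [corner_succ, corner_succ, ih (fun k hk => h k (hk.trans n.lt_succ_self)),
      h n n.lt_succ_self]

/-- The choices made in the first `n` steps. -/
def choices (N : ℕ → ℕ) (n : ℕ) : Finset (Σ n : ℕ, Node N (n + 1)) :=
  (Finset.range n).sigma fun _ => Finset.univ

open scoped Classical in
/-- An outcome with prescribed first `n` steps. -/
noncomputable def extend (hM : ∀ n, 2 ≤ M n) (n : ℕ)
    (z : ∀ i : choices N n, (Fin 2 → Fin (M i.1.1))) : Sample M N := fun i =>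
  if h : i ∈ choices N n then z ⟨i, h⟩ else fun _ => ⟨0, zero_lt_two.trans_le (hM _)⟩

theorem corner_extend_restrict (hM : ∀ n, 2 ≤ M n) (ω : Sample M N) (n : ℕ) (v : Node N n) :
    corner (extend hM n ((choices N n).restrict ω)) n v = corner ω n v :=
  corner_congr (fun k hk w => by
    have h : (⟨k, w⟩ : Σ n : ℕ, Node N (n + 1)) ∈ choices N n := by simp [choices, hk]
    simp [extend, h]) v

/-- Level `n` corners depend on finitely many choices with finitely many values each, so any
function of them is measurable. -/
theorem measurable_corner_comp (hM : ∀ n, 2 ≤ M n) {α : Type*} [MeasurableSpace α] (n : ℕ)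
    (F : (Node N n → Fin 2 → ℝ) → α) :
    Measurable fun ω : Sample M N => F (corner ω n) := by
  have h : (fun ω : Sample M N => F (corner ω n)) =
      (fun z => F (corner (extend hM n z) n)) ∘ (choices N n).restrict := by
    funext ω
    simp only [Function.comp_apply]
    congr 1
    funext v
    exact (corner_extend_restrict hM ω n v).symm
  rw [h]
  exact (measurable_of_countable _).comp (Finset.measurable_restrict _)

theorem isProbabilityMeasure_uniformOn_position (hM : ∀ n, 2 ≤ M n) (n : ℕ) :
    IsProbabilityMeasure (uniformOn (Set.univ : Set (Fin 2 → Fin (M n)))) :=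
  have : Nonempty (Fin (M n)) := ⟨⟨0, zero_lt_two.trans_le (hM n)⟩⟩
  isProbabilityMeasure_uniformOn_univ

theorem isProbabilityMeasure_law (hM : ∀ n, 2 ≤ M n) : IsProbabilityMeasure (law M N) :=
  have := fun v : Σ n : ℕ, Node N (n + 1) => isProbabilityMeasure_uniformOn_position hM v.1
  inferInstanceAs (IsProbabilityMeasure (Measure.infinitePi _))

/-! ### Exponential moments. -/

/-- The mean of `G` over the corners of the squares of level `n`. -/
noncomputable def cornerMean (G : (Fin 2 → ℝ) → ℝ) (n : ℕ) (ω : Sample M N) : ℝ :=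
  (count N n)⁻¹ * ∑ v : Node N n, G (corner ω n v)

theorem measurable_cornerMean (hM : ∀ n, 2 ≤ M n) (G : (Fin 2 → ℝ) → ℝ) (n : ℕ) :
    Measurable (cornerMean G n : Sample M N → ℝ) :=
  measurable_corner_comp hM n fun c => (count N n)⁻¹ * ∑ v : Node N n, G (c v)

theorem sum_parent (n : ℕ) (h : Node N n → ℝ) :
    ∑ v : Node N (n + 1), h v.parent = N n * ∑ v, h v := by
  rw [← Fintype.sum_equiv (Fin.snocEquiv fun k : Fin (n + 1) => Fin (N k)) (fun q => h q.2) _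
    fun q => by
      congr 1
      funext k
      simp [Node.parent, Fin.snocEquiv], Fintype.sum_prod_type]
  simp

/-- For `0 ≤ z ≤ l * b ≤ 1` one has `exp z ≤ 1 + z + z² ≤ 1 + (1 + l * b) z`. After averaging, `1 +
x ≤ exp x` returns to an exponential. -/
theorem mean_exp_le {α : Type*} [Fintype α] [Nonempty α] (ξ : α → ℝ) {l b : ℝ} (hl : 0 ≤ l)
    (h0 : ∀ x, 0 ≤ ξ x) (hb : ∀ x, ξ x ≤ b) (hlb : l * b ≤ 1) :
    (Fintype.card α : ℝ)⁻¹ * ∑ x, Real.exp (l * ξ x) ≤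
      Real.exp (l * (1 + l * b) * ((Fintype.card α : ℝ)⁻¹ * ∑ x, ξ x)) := by
  have hc : (0 : ℝ) < Fintype.card α := by exact_mod_cast Fintype.card_pos
  have h1 : ∀ x, Real.exp (l * ξ x) ≤ 1 + l * (1 + l * b) * ξ x := fun x => by
    have h2 : 0 ≤ l * ξ x := mul_nonneg hl (h0 x)
    have h3 : l * ξ x ≤ l * b := mul_le_mul_of_nonneg_left (hb x) hl
    have h4 := (abs_le.1 (Real.abs_exp_sub_one_sub_id_le
      (abs_le.2 ⟨by linarith, h3.trans hlb⟩))).2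
    nlinarith
  calc (Fintype.card α : ℝ)⁻¹ * ∑ x, Real.exp (l * ξ x)
      ≤ (Fintype.card α : ℝ)⁻¹ * ∑ x, (1 + l * (1 + l * b) * ξ x) := by gcongr with x; exact h1 x
    _ = l * (1 + l * b) * ((Fintype.card α : ℝ)⁻¹ * ∑ x, ξ x) + 1 := by
      rw [Finset.sum_add_distrib, ← Finset.mul_sum]
      simp [mul_add, hc.ne']
      ring
    _ ≤ _ := Real.add_one_le_exp _

theorem lintegral_uniformOn_ofReal {α : Type*} [Fintype α] [Nonempty α] [MeasurableSpace α]
    [MeasurableSingletonClass α] (f : α → ℝ) (hf : ∀ x, 0 ≤ f x) :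
    ∫⁻ x, ENNReal.ofReal (f x) ∂uniformOn (Set.univ : Set α) =
      ENNReal.ofReal ((Fintype.card α : ℝ)⁻¹ * ∑ x, f x) := by
  have hc : (0 : ℝ) < Fintype.card α := by exact_mod_cast Fintype.card_pos
  simp only [lintegral_fintype, uniformOn_univ_singleton]
  rw [← Finset.sum_mul, ENNReal.ofReal_mul (by positivity), ENNReal.ofReal_inv_of_pos hc,
    ENNReal.ofReal_sum_of_nonneg fun x _ => hf x, ENNReal.ofReal_natCast, mul_comm]

/-- The one step estimate for exponential moments. -/
theorem lintegral_exp_cornerMean_succ_le (hM : ∀ n, 2 ≤ M n) (hN : ∀ n, 1 ≤ N n) (n : ℕ)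
    {G G' : (Fin 2 → ℝ) → ℝ} (hG : ∀ p, G p = ((M n : ℝ) ^ 2)⁻¹ * ∑ d : Fin 2 → Fin (M n),
      G' (fun a => p a + side M (n + 1) * (d a : ℕ)))
    (h0 : ∀ p, 0 ≤ G' p) {l b : ℝ} (hb : ∀ p, (count N (n + 1))⁻¹ * G' p ≤ b) (hl : 0 ≤ l)
    (hlb : l * b ≤ 1) :
    ∫⁻ ω, ENNReal.ofReal (Real.exp (l * cornerMean G' (n + 1) ω)) ∂law M N ≤
      ∫⁻ ω, ENNReal.ofReal (Real.exp (l * (1 + l * b) * cornerMean G n ω)) ∂law M N := by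
  have := fun v : Σ n : ℕ, Node N (n + 1) => isProbabilityMeasure_uniformOn_position hM v.1
  have hpos := count_pos hN (n + 1)
  set T : Finset (Σ n : ℕ, Node N (n + 1)) :=
    Finset.univ.map ⟨Sigma.mk n, sigma_mk_injective⟩ with hT
  have hST : Disjoint (choices N n) T := by
    rw [Finset.disjoint_left]
    rintro ⟨k, w⟩ h1 h2
    simp only [choices, Finset.mem_sigma, Finset.mem_range, Finset.mem_univ, and_true] at h1
    simp only [hT, Finset.mem_map, Finset.mem_univ, true_and, Function.Embedding.coeFn_mk] at h2
    obtain ⟨v, hv⟩ := h2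
    have : n = k := congrArg Sigma.fst hv
    omega
  -- Only labels in `T` matter here. Their parents' corners are fixed by the first `n` steps, so the
  -- filler values in `extend` play no role.
  set g : ∀ i : Σ n : ℕ, Node N (n + 1), (Fin 2 → Fin (M i.1)) →
      (∀ i : choices N n, (Fin 2 → Fin (M i.1.1))) → ENNReal := fun i x z =>
    ENNReal.ofReal (Real.exp (l * ((count N (n + 1))⁻¹ * G' (fun a =>
      corner (extend hM n z) i.1 i.2.parent a + side M (i.1 + 1) * (x a : ℕ))))) with hg
  have h1 : ∀ ω : Sample M N, ENNReal.ofReal (Real.exp (l * cornerMean G' (n + 1) ω)) =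
      ∏ i ∈ T, g i (ω i) ((choices N n).restrict ω) := fun ω => by
    rw [hT, Finset.prod_map]
    simp only [hg, Function.Embedding.coeFn_mk, corner_extend_restrict]
    rw [← ENNReal.ofReal_prod_of_nonneg fun _ _ => (Real.exp_pos _).le, ← Real.exp_sum,
      ← Finset.mul_sum, ← Finset.mul_sum]
    rfl
  simp_rw [h1]
  rw [law, lintegral_infinitePi_prod _ hST]
  refine lintegral_mono fun ω => ?_
  rw [hT, Finset.prod_map]
  simp only [hg, Function.Embedding.coeFn_mk, corner_extend_restrict]
  have hne : Nonempty (Fin (M n)) := ⟨⟨0, zero_lt_two.trans_le (hM n)⟩⟩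
  have hstep : ∀ v : Node N (n + 1),
      ∫⁻ x, ENNReal.ofReal (Real.exp (l * ((count N (n + 1))⁻¹ * G' (fun a =>
        corner ω n v.parent a + side M (n + 1) * (x a : ℕ)))))
        ∂uniformOn (Set.univ : Set (Fin 2 → Fin (M n))) ≤
      ENNReal.ofReal (Real.exp (l * (1 + l * b) *
        ((count N (n + 1))⁻¹ * G (corner ω n v.parent)))) := fun v => by
    rw [lintegral_uniformOn_ofReal _ fun _ => (Real.exp_pos _).le]
    refine ENNReal.ofReal_le_ofReal ((mean_exp_le _ hl
      (fun x => mul_nonneg (inv_pos.2 hpos).le (h0 _)) (fun x => hb _) hlb).trans_eq ?_)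
    rw [hG, ← Finset.mul_sum]
    congr 2
    simp
    ring
  refine (Finset.prod_le_prod' fun v _ => hstep v).trans_eq ?_
  rw [← ENNReal.ofReal_prod_of_nonneg fun _ _ => (Real.exp_pos _).le, ← Real.exp_sum,
    ← Finset.mul_sum, ← Finset.mul_sum, sum_parent n fun w => G (corner ω n w), cornerMean]
  have hNn : (N n : ℝ) ≠ 0 := by exact_mod_cast (Nat.one_le_iff_ne_zero.1 (hN n))
  rw [count, Finset.prod_range_succ, ← count, mul_inv, mul_assoc, mul_assoc, ← mul_assoc _ (N n : ℝ),
    inv_mul_cancel₀ hNn, one_mul, mul_assoc]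

/-- Iteration of the one step estimate for exponential moments. -/
theorem lintegral_exp_cornerMean_le (hM : ∀ n, 2 ≤ M n) (hN : ∀ n, 1 ≤ N n) {m : ℕ}
    {G : ℕ → (Fin 2 → ℝ) → ℝ} (hG : ∀ n < m, ∀ p, G n p = ((M n : ℝ) ^ 2)⁻¹ *
      ∑ d : Fin 2 → Fin (M n), G (n + 1) (fun a => p a + side M (n + 1) * (d a : ℕ)))
    (h0 : ∀ n p, 0 ≤ G n p) {b : ℕ → ℝ} (hb : ∀ n ≤ m, ∀ p, (count N n)⁻¹ * G n p ≤ b n)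
    (hb0 : ∀ n, 0 ≤ b n) {L : ℝ} (hL : 0 ≤ L)
    (hsum : ∑ n ∈ Finset.range m, L * b (n + 1) ≤ 1) :
    ∫⁻ ω, ENNReal.ofReal (Real.exp (L * Real.exp (-1) * cornerMean (G m) m ω)) ∂law M N ≤
      ENNReal.ofReal (Real.exp (L * G 0 0)) := by
  have := isProbabilityMeasure_law (N := N) hM
  -- The parameters decrease so that `l (n + 1) * (1 + L * b (n + 1)) = l n`, which pays exactly for
  -- the loss in one step since `l (n + 1) ≤ L`.
  set l : ℕ → ℝ := fun n => L * (∏ k ∈ Finset.range n, (1 + L * b (k + 1)))⁻¹ with hl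
  have hLb : ∀ n, 0 ≤ L * b n := fun n => mul_nonneg hL (hb0 n)
  have hprod : ∀ n, 1 ≤ ∏ k ∈ Finset.range n, (1 + L * b (k + 1)) := fun n =>
    Finset.one_le_prod fun k _ => le_add_of_nonneg_right (hLb (k + 1))
  have hl0 : ∀ n, 0 ≤ l n := fun n =>
    mul_nonneg hL (inv_nonneg.2 (zero_le_one.trans (hprod n)))
  have hlL : ∀ n, l n ≤ L := fun n => mul_le_of_le_one_right hL (inv_le_one_of_one_le₀ (hprod n))
  have hcm : ∀ n ω, 0 ≤ cornerMean (G n) n (ω : Sample M N) := fun n ω =>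
    mul_nonneg (inv_nonneg.2 (count_pos hN n).le) (Finset.sum_nonneg fun v _ => h0 _ _)
  have key : ∀ n ≤ m, ∫⁻ ω, ENNReal.ofReal (Real.exp (l n * cornerMean (G n) n ω)) ∂law M N ≤
      ENNReal.ofReal (Real.exp (L * G 0 0)) := by
    intro n
    induction n with
    | zero =>
      intro _
      have h : ∀ ω : Sample M N, cornerMean (G 0) 0 ω = G 0 0 := fun ω => by
        simp [cornerMean, count, corner]
      simp [h, hl]
    | succ n ih =>
      intro hn
      have hterm : L * b (n + 1) ≤ 1 := le_trans (Finset.single_le_sum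
        (f := fun n => L * b (n + 1)) (fun k _ => hLb (k + 1)) (Finset.mem_range.2 hn)) hsum
      have hlb : l (n + 1) * b (n + 1) ≤ L * b (n + 1) :=
        mul_le_mul_of_nonneg_right (hlL _) (hb0 _)
      refine (lintegral_exp_cornerMean_succ_le hM hN n (hG n hn) (h0 _) (hb _ hn) (hl0 _)
        (hlb.trans hterm)).trans ((lintegral_mono fun ω => ?_).trans (ih (by omega)))
      refine ENNReal.ofReal_le_ofReal (Real.exp_le_exp.2
        (mul_le_mul_of_nonneg_right ?_ (hcm n ω)))
      have hne : (1 + L * b (n + 1)) ≠ 0 := by linarith [hLb (n + 1)]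
      have h1 : l (n + 1) * (1 + L * b (n + 1)) = l n := by
        simp only [hl, Finset.prod_range_succ, mul_inv]
        rw [mul_assoc, mul_assoc, inv_mul_cancel₀ hne, mul_one]
      rw [← h1]
      exact mul_le_mul_of_nonneg_left (by linarith) (hl0 _)
  refine (lintegral_mono fun ω => ?_).trans (key m le_rfl)
  refine ENNReal.ofReal_le_ofReal (Real.exp_le_exp.2 (mul_le_mul_of_nonneg_right ?_ (hcm m ω)))
  refine mul_le_mul_of_nonneg_left ?_ hL
  -- The total loss is at most a factor `e`, because `∏ (1 + x_k) ≤ exp (∑ x_k) ≤ e`.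
  rw [Real.exp_neg]
  refine inv_anti₀ (zero_lt_one.trans_le (hprod m)) ?_
  calc ∏ k ∈ Finset.range m, (1 + L * b (k + 1))
      ≤ ∏ k ∈ Finset.range m, Real.exp (L * b (k + 1)) :=
        Finset.prod_le_prod (fun k _ => by linarith [hLb (k + 1)]) fun k _ => by
          linarith [Real.add_one_le_exp (L * b (k + 1))]
    _ = Real.exp (∑ k ∈ Finset.range m, L * b (k + 1)) := (Real.exp_sum _ _).symm
    _ ≤ Real.exp 1 := Real.exp_le_exp.2 hsum

/-! ### Tail bound for a single strip. -/

/-- After taking logarithms, `t` below the liminf says that `P_n⁻¹ ≤ r_n ^ t` for all large `n`; the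
constant `K` takes care of the remaining levels. -/
theorem exists_inv_count_le (hM : ∀ n, 2 ≤ M n) (hN : ∀ n, 1 ≤ N n) {t : ℝ}
    (ht : t < dimension M N) : ∃ K, 1 ≤ K ∧ ∀ n, (count N n)⁻¹ ≤ K * side M n ^ t := by
  have hlog : ∀ k, 0 < Real.log (M k) := fun k =>
    Real.log_pos (by exact_mod_cast one_lt_two.trans_le (hM k))
  have hev := eventually_lt_of_lt_liminf ht (isBoundedUnder_of ⟨0, fun n =>
    div_nonneg (Finset.sum_nonneg fun k _ => Real.log_natCast_nonneg _)
      (Finset.sum_nonneg fun k _ => (hlog k).le)⟩)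
  have hbdd : BddAbove (Set.range fun n => (count N n)⁻¹ / side M n ^ t) := by
    refine IsBoundedUnder.bddAbove_range ⟨1, eventually_map.2 ?_⟩
    filter_upwards [hev, eventually_gt_atTop 0] with n hn hn0
    have hpos : 0 < ∑ k ∈ Finset.range n, Real.log (M k) :=
      Finset.sum_pos (fun k _ => hlog k) ⟨0, Finset.mem_range.2 hn0⟩
    rw [lt_div_iff₀ hpos] at hn
    rw [div_le_one (Real.rpow_pos_of_pos (side_pos hM n) t),
      ← Real.log_le_log_iff (inv_pos.2 (count_pos hN n))
        (Real.rpow_pos_of_pos (side_pos hM n) t), Real.log_inv,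
      Real.log_rpow (side_pos hM n), side, Real.log_inv, count,
      Real.log_prod fun k _ => Nat.cast_ne_zero.2 (Nat.one_le_iff_ne_zero.1 (hN k)),
      Real.log_prod fun k _ => Nat.cast_ne_zero.2 (zero_lt_two.trans_le (hM k)).ne']
    linarith
  obtain ⟨K, hK⟩ := hbdd
  refine ⟨max 1 K, le_max_left _ _, fun n => ?_⟩
  rw [← div_le_iff₀ (Real.rpow_pos_of_pos (side_pos hM n) t)]
  exact (hK ⟨n, rfl⟩).trans (le_max_right _ _)

/-- Tail bound for the mass of a strip, uniform in the strip. -/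
theorem exists_tail_bound (hM : ∀ n, 2 ≤ M n) (hN : ∀ n, 1 ≤ N n) {t t₁ : ℝ} (ht0 : 0 ≤ t)
    (ht1 : t ≤ 1) (htt : t < t₁) (ht : t₁ < dimension M N) :
    ∃ c : ℝ, 0 < c ∧ ∀ (u : Fin 2 → ℝ) (b : Fin 2), 1 / 2 ≤ |u b| → ∀ (a ρ : ℝ), 0 < ρ → ρ ≤ 1 →
      ∀ m, side M m ≤ ρ → ∀ y : ℝ,
        law M N {ω | y ≤ cornerMean ((strip u a (6 * ρ)).indicator 1) m ω} ≤
          ENNReal.ofReal (Real.exp (25 - c * (y * ρ ^ (-t)))) := by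
  obtain ⟨K, hK1, hK⟩ := exists_inv_count_le hM hN ht
  set q : ℝ := (1 / 2 : ℝ) ^ (t₁ - t) with hq
  have hq0 : 0 < q := Real.rpow_pos_of_pos (by norm_num) _
  have hq1 : q < 1 := Real.rpow_lt_one (by norm_num) (by norm_num) (by linarith)
  set K₁ : ℝ := 25 * K / (1 - q) with hK₁
  have hK₁1 : 1 ≤ K₁ := by
    rw [hK₁, le_div_iff₀ (by linarith)]
    linarith
  refine ⟨Real.exp (-1) / K₁, by positivity, fun u b hu a ρ hρ0 hρ1 m hm y => ?_⟩
  set φ : (Fin 2 → ℝ) → ℝ := (strip u a (6 * ρ)).indicator 1 with hφ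
  have hφ0 : ∀ p, 0 ≤ φ p := fun p => Set.indicator_nonneg (fun _ _ => zero_le_one) p
  have hφ1 : ∀ p, φ p ≤ 1 := fun p => Set.indicator_le_self' (fun _ _ => zero_le_one) p
  have hρt : 0 < ρ ^ t := Real.rpow_pos_of_pos hρ0 t
  have hρt' : ρ ^ (-t) * ρ ^ t = 1 := by
    rw [← Real.rpow_add hρ0, neg_add_cancel, Real.rpow_zero]
  have hb : ∀ n ≤ m, ∀ p, (count N n)⁻¹ * levelMean M φ m n p ≤ 25 * K * ρ ^ t * q ^ n := by
    intro n hn p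
    have hs := side_pos hM n
    have hx : 0 < 25 * ρ / side M n := by positivity
    -- This is `min(1, x) ≤ x ^ t`, valid for `0 ≤ t ≤ 1`.
    have h1 : levelMean M φ m n p ≤ (25 * ρ / side M n) ^ t := by
      rcases le_total (25 * ρ / side M n) 1 with h | h
      · exact (levelMean_strip_le hM hu hn hm a p).trans
          (Real.self_le_rpow_of_le_one hx.le h ht1)
      · exact (gridMean_le_one hφ1 _ _ _).trans (Real.one_le_rpow h ht0)
    have h2 : (25 * ρ / side M n) ^ t ≤ 25 * ρ ^ t / side M n ^ t := by
      rw [Real.div_rpow (by positivity) hs.le, Real.mul_rpow (by norm_num) hρ0.le]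
      gcongr
      exact Real.rpow_le_self_of_one_le (by norm_num) ht1
    have h3 : side M n ^ (t₁ - t) ≤ q ^ n := by
      rw [hq, ← Real.rpow_natCast, ← Real.rpow_mul (by norm_num), mul_comm,
        Real.rpow_mul (by norm_num), Real.rpow_natCast]
      exact Real.rpow_le_rpow hs.le (side_le_pow hM n) (by linarith)
    calc (count N n)⁻¹ * levelMean M φ m n p
        ≤ K * side M n ^ t₁ * (25 * ρ ^ t / side M n ^ t) :=
          mul_le_mul (hK n) (h1.trans h2) (gridMean_nonneg hφ0 _ _ _) (by positivity)
      _ = 25 * K * ρ ^ t * side M n ^ (t₁ - t) := by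
          rw [Real.rpow_sub hs]; ring
      _ ≤ _ := by gcongr
  -- The choice of `K₁` makes `L * b (n + 1) ≤ (1 - q) * q ^ n`, whose sum over `n` is at most `1`.
  set L : ℝ := ρ ^ (-t) / K₁ with hL
  have hL0 : 0 < L := by positivity
  have hmgf := lintegral_exp_cornerMean_le (N := N) hM hN (m := m) (G := levelMean M φ m)
    (fun n hn p => levelMean_eq hM φ hn p) (fun n p => gridMean_nonneg hφ0 _ _ _)
    hb (fun n => by positivity) hL0.le (by
      have h1 : ∀ n, L * (25 * K * ρ ^ t * q ^ (n + 1)) ≤ (1 - q) * q ^ n := fun n => by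
        have : L * (25 * K * ρ ^ t * q ^ (n + 1)) =
            (ρ ^ (-t) * ρ ^ t) * ((1 - q) * q ^ n) * q := by
          have : 1 - q ≠ 0 := by linarith
          rw [hL, hK₁]
          field_simp
          exact pow_succ' q n
        rw [this, hρt', one_mul]
        exact mul_le_of_le_one_right (mul_nonneg (by linarith) (by positivity)) hq1.le
      refine (Finset.sum_le_sum fun n _ => h1 n).trans ?_
      rw [← Finset.mul_sum, mul_comm, geom_sum_mul_neg]
      linarith [pow_pos hq0 m])
  rw [levelMean_self] at hmgf
  have hG0 : L * levelMean M φ m 0 0 ≤ 25 := by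
    have h1 := levelMean_strip_le hM hu (Nat.zero_le m) hm a 0
    have h2 : side M 0 = 1 := by simp [side]
    rw [h2, div_one] at h1
    have h3 : ρ ^ (-t) * ρ ≤ 1 := by
      rw [← hρt']
      gcongr
      exact Real.self_le_rpow_of_le_one hρ0.le hρ1 ht1
    have h4 : L * ρ ≤ 1 := by
      rw [hL, div_mul_eq_mul_div, div_le_one (by linarith)]
      linarith
    calc L * levelMean M φ m 0 0 ≤ L * (25 * ρ) := mul_le_mul_of_nonneg_left h1 hL0.le
      _ ≤ 25 := by linarith
  have hmeas := measurable_cornerMean (N := N) hM φ m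
  have hmk := mul_meas_ge_le_lintegral (μ := law M N) (f := fun ω : Sample M N =>
    ENNReal.ofReal (Real.exp (L * Real.exp (-1) * cornerMean φ m ω)))
    (by fun_prop) (ENNReal.ofReal (Real.exp (L * Real.exp (-1) * y)))
  have hsub : {ω : Sample M N | y ≤ cornerMean φ m ω} ⊆
      {ω | ENNReal.ofReal (Real.exp (L * Real.exp (-1) * y)) ≤
        ENNReal.ofReal (Real.exp (L * Real.exp (-1) * cornerMean φ m ω))} := fun ω hω =>
    ENNReal.ofReal_le_ofReal (Real.exp_le_exp.2 (mul_le_mul_of_nonneg_left hω (by positivity)))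
  refine (measure_mono hsub).trans ?_
  have he : Real.exp (25 - Real.exp (-1) / K₁ * (y * ρ ^ (-t))) =
      Real.exp 25 / Real.exp (L * Real.exp (-1) * y) := by
    rw [← Real.exp_sub, hL]
    congr 1
    ring
  rw [he, ENNReal.ofReal_div_of_pos (Real.exp_pos _),
    ENNReal.le_div_iff_mul_le (Or.inl (ENNReal.ofReal_pos.2 (Real.exp_pos _)).ne')
      (Or.inl ENNReal.ofReal_ne_top), mul_comm]
  exact (hmk.trans hmgf).trans (ENNReal.ofReal_le_ofReal (Real.exp_le_exp.2 hG0))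

/-! ### Union bound over a net of strips and over scales. -/

theorem summable_pow_mul_exp_neg {A B c Q : ℝ} (hA : 0 < A) (hc : 0 < c) (hQ : 1 < Q) :
    Summable fun j : ℕ => A ^ j * Real.exp (B - c * Q ^ j) := by
  have h1 : Tendsto (fun j : ℕ => (j : ℝ) ^ 1 / Q ^ j) atTop (𝓝 0) :=
    tendsto_pow_const_div_const_pow_of_one_lt 1 hQ
  have h2 : Summable fun j : ℕ => Real.exp B * Real.exp (-j) :=
    Real.summable_exp_neg_nat.mul_left _
  refine Summable.of_norm_bounded_eventually_nat h2 ?_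
  have hD : 0 < c / (|Real.log A| + 1) := by positivity
  filter_upwards [h1.eventually (gt_mem_nhds hD)] with j hj
  have hQj : 0 < Q ^ j := pow_pos (zero_lt_one.trans hQ) j
  rw [pow_one, div_lt_div_iff₀ hQj (by positivity)] at hj
  rw [Real.norm_of_nonneg (by positivity), ← Real.exp_add, ← Real.exp_log (pow_pos hA j),
    Real.log_pow, ← Real.exp_add]
  have := mul_le_mul_of_nonneg_left (le_abs_self (Real.log A)) (Nat.cast_nonneg (α := ℝ) j)
  exact Real.exp_le_exp.2 (by linarith)

/-- Integer parameters of the strips of scale `2⁻ʲ`. -/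
noncomputable def netIndex (j : ℕ) : Finset (ℤ × ℤ × ℤ) :=
  Finset.Icc (-2 ^ (j + 3)) (2 ^ (j + 3)) ×ˢ
    (Finset.Icc (-2 ^ (j + 3)) (2 ^ (j + 3)) ×ˢ Finset.Icc (-2 ^ (j + 3)) (2 ^ (j + 3)))

theorem card_netIndex_le (j : ℕ) : ((netIndex j).card : ℝ) ≤ 2 ^ 15 * 8 ^ j := by
  have h : (Finset.Icc (-2 ^ (j + 3)) (2 ^ (j + 3) : ℤ)).card ≤ 2 ^ (j + 5) := by
    rw [Int.card_Icc, Int.toNat_le]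
    push_cast
    have : (1 : ℤ) ≤ 2 ^ j := one_le_pow₀ (by norm_num)
    rw [pow_add, pow_add]
    linarith
  have h2 : (netIndex j).card ≤ 2 ^ (j + 5) * (2 ^ (j + 5) * 2 ^ (j + 5)) := by
    rw [netIndex, Finset.card_product, Finset.card_product]
    gcongr
  calc ((netIndex j).card : ℝ) ≤ 2 ^ (j + 5) * (2 ^ (j + 5) * 2 ^ (j + 5)) := by exact_mod_cast h2
    _ = 2 ^ 15 * 8 ^ j := by
      rw [show (8 : ℝ) = 2 ^ 3 by norm_num, ← pow_mul]
      ring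

/-- The direction vector with given integer parameters at scale `ρ`. -/
def netVector (ρ : ℝ) (k : ℤ × ℤ × ℤ) : Fin 2 → ℝ := ![ρ * k.1, ρ * k.2.1]

open scoped Classical in
/-- The event that some strip of scale `2⁻ʲ` has large mass. -/
noncomputable def badEvent (M N : ℕ → ℕ) (t : ℝ) (m : ℕ → ℕ) (j : ℕ) : Set (Sample M N) :=
  ⋃ k ∈ (netIndex j).filter fun k => ∃ b, 1 / 2 ≤ |netVector ((1 / 2) ^ j) k b|,
    {ω | ((1 / 2 : ℝ) ^ j) ^ t ≤ cornerMean ((strip (netVector ((1 / 2) ^ j) k)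
      ((1 / 2) ^ j * k.2.2) (6 * (1 / 2) ^ j)).indicator 1) (m j) ω}

theorem measurableSet_badEvent (hM : ∀ n, 2 ≤ M n) (t : ℝ) (m : ℕ → ℕ) (j : ℕ) :
    MeasurableSet (badEvent M N t m j) :=
  Finset.measurableSet_biUnion _ fun _ _ =>
    measurableSet_le measurable_const (measurable_cornerMean hM _ _)

theorem exists_law_iUnion_badEvent_lt_one (hM : ∀ n, 2 ≤ M n) (hN : ∀ n, 1 ≤ N n) {t : ℝ}
    (ht0 : 0 ≤ t) (ht1 : t < 1) (ht : t < dimension M N) {m : ℕ → ℕ}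
    (hm : ∀ j, side M (m j) ≤ (1 / 2) ^ j) :
    ∃ j₀, 3 ≤ j₀ ∧ law M N (⋃ j, badEvent M N t m (j + j₀)) < 1 := by
  classical
  -- The gap `t₂ - t` makes the exponent in the tail bound grow like `Q ^ j`, beating the `8 ^ j`
  -- strips; the gap `t₁ - t₂` is the one that the tail bound at exponent `t₂` requires.
  obtain ⟨t₂, ht2, ht2'⟩ := exists_between (lt_min ht1 ht)
  obtain ⟨t₁, ht3, ht3'⟩ := exists_between (ht2'.trans_le (min_le_right _ _))
  obtain ⟨c, hc, htail⟩ := exists_tail_bound hM hN (ht0.trans ht2.le)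
    (ht2'.trans_le (min_le_left _ _)).le ht3 ht3'
  set Q : ℝ := 2 ^ (t₂ - t) with hQ
  have hQ1 : 1 < Q := Real.one_lt_rpow one_lt_two (by linarith)
  set f : ℕ → ℝ := fun j => 2 ^ 15 * (8 ^ j * Real.exp (25 - c * Q ^ j)) with hf
  have hf0 : ∀ j, 0 ≤ f j := fun j => by positivity
  have hsum : Summable f := (summable_pow_mul_exp_neg (by norm_num) hc hQ1).mul_left _
  have hbad : ∀ j, law M N (badEvent M N t m j) ≤ ENNReal.ofReal (f j) := by
    intro j
    have hy : ((1 / 2 : ℝ) ^ j) ^ t * ((1 / 2 : ℝ) ^ j) ^ (-t₂) = Q ^ j := by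
      rw [← Real.rpow_add (by positivity), hQ, ← Real.rpow_natCast, ← Real.rpow_natCast,
        ← Real.rpow_mul (by norm_num), ← Real.rpow_mul (by norm_num), one_div,
        Real.inv_rpow (by norm_num), ← Real.rpow_neg (by norm_num)]
      congr 1
      ring
    refine (measure_biUnion_finset_le _ _).trans ((Finset.sum_le_card_nsmul _ _
      (ENNReal.ofReal (Real.exp (25 - c * Q ^ j))) fun k hk => ?_).trans ?_)
    · obtain ⟨b, hb⟩ := (Finset.mem_filter.1 hk).2
      have := htail _ b hb ((1 / 2) ^ j * k.2.2) ((1 / 2) ^ j) (by positivity)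
        (pow_le_one₀ (by norm_num) (by norm_num)) (m j) (hm j) (((1 / 2 : ℝ) ^ j) ^ t)
      rwa [hy] at this
    · rw [nsmul_eq_mul, ← ENNReal.ofReal_natCast, ← ENNReal.ofReal_mul (Nat.cast_nonneg _)]
      refine ENNReal.ofReal_le_ofReal ?_
      rw [hf]
      dsimp only
      rw [← mul_assoc]
      refine mul_le_mul_of_nonneg_right ?_ (Real.exp_pos _).le
      exact (Nat.cast_le.2 (Finset.card_filter_le _ _)).trans (card_netIndex_le j)
  obtain ⟨j₀, hj₀, hlt⟩ := ((eventually_ge_atTop 3).and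
    ((tendsto_sum_nat_add f).eventually (gt_mem_nhds zero_lt_one))).exists
  refine ⟨j₀, hj₀, ?_⟩
  calc law M N (⋃ j, badEvent M N t m (j + j₀))
      ≤ ∑' j, law M N (badEvent M N t m (j + j₀)) := measure_iUnion_le _
    _ ≤ ∑' j, ENNReal.ofReal (f (j + j₀)) := ENNReal.tsum_le_tsum fun j => hbad _
    _ = ENNReal.ofReal (∑' j, f (j + j₀)) :=
        (ENNReal.ofReal_tsum_of_nonneg (fun j => hf0 _) ((summable_nat_add_iff j₀).2 hsum)).symm
    _ < 1 := by rwa [ENNReal.ofReal_lt_one]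

/-! ### From lines to strips of the net. -/

theorem exists_unit_vector (ℓ : AffineSubspace ℝ Plane) (h : Module.finrank ℝ ℓ.direction = 1) :
    ∃ u ∈ ℓ.direction, ‖u‖ = 1 := by
  have : Nontrivial ℓ.direction := Module.nontrivial_of_finrank_pos (R := ℝ) (by omega)
  obtain ⟨w, hw⟩ := exists_ne (0 : ℓ.direction)
  have hw' : (w : Plane) ≠ 0 := fun h => hw (Subtype.ext h)
  exact ⟨(‖(w : Plane)‖⁻¹ : ℝ) • (w : Plane), ℓ.direction.smul_mem _ w.2,
    by rw [norm_smul, norm_inv, norm_norm, inv_mul_cancel₀ (norm_ne_zero_iff.2 hw')]⟩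

theorem abs_lt_of_mem_preimage_ball (ℓ : AffineSubspace ℝ Plane) [Nonempty ℓ] {u : Plane}
    (hu : u ∈ ℓ.direction) (hu1 : ‖u‖ = 1) {x : ℓ} {r : ℝ} {y : Plane}
    (hy : EuclideanGeometry.orthogonalProjection ℓ y ∈ Metric.ball x r) :
    |u 0 * y 0 + u 1 * y 1 - (u 0 * (x : Plane) 0 + u 1 * (x : Plane) 1)| < r := by
  have h1 : inner ℝ u (y - EuclideanGeometry.orthogonalProjection ℓ y) = 0 :=
    ℓ.direction.inner_right_of_mem_orthogonal hu
      (EuclideanGeometry.vsub_orthogonalProjection_mem_direction_orthogonal ℓ y)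
  have h2 : inner ℝ u (y - (x : Plane)) =
      inner ℝ u ((EuclideanGeometry.orthogonalProjection ℓ y : Plane) - x) := by
    rw [← sub_add_sub_cancel y (EuclideanGeometry.orthogonalProjection ℓ y : Plane) (x : Plane),
      inner_add_right, h1, zero_add]
  have h3 : u 0 * y 0 + u 1 * y 1 - (u 0 * (x : Plane) 0 + u 1 * (x : Plane) 1) =
      inner ℝ u (y - (x : Plane)) := by
    simp [PiLp.inner_apply, Fin.sum_univ_two]
    ring
  rw [h3, h2]
  refine (abs_real_inner_le_norm _ _).trans_lt ?_
  rw [hu1, one_mul, ← dist_eq_norm]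
  exact hy

theorem floor_mem_Icc {j : ℕ} {z C : ℝ} (hz : |z| ≤ C) (hC : C ≤ 3) :
    ⌊z / (1 / 2) ^ j⌋ ∈ Finset.Icc (-2 ^ (j + 3) : ℤ) (2 ^ (j + 3)) := by
  have h : z / (1 / 2) ^ j = z * 2 ^ j := by
    rw [one_div, inv_pow, div_inv_eq_mul]
  have h2 : (1 : ℝ) ≤ 2 ^ j := one_le_pow₀ (by norm_num)
  rw [abs_le] at hz
  rw [h, Finset.mem_Icc, Int.le_floor, ← @Int.cast_le ℝ]
  push_cast
  have h3 := Int.floor_le (z * 2 ^ j)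
  rw [pow_add]
  constructor <;> nlinarith

theorem mul_floor_div_bounds {ρ : ℝ} (hρ : 0 < ρ) (z : ℝ) :
    0 ≤ z - ρ * ⌊z / ρ⌋ ∧ z - ρ * ⌊z / ρ⌋ ≤ ρ := by
  have h1 : z = ρ * (z / ρ) := by field_simp
  have h2 := Int.floor_le (z / ρ)
  have h3 := (Int.lt_floor_add_one (z / ρ)).le
  constructor <;> nlinarith

/-- Outside the bad event of scale `2⁻ʲ`, all strips of width comparable to `2⁻ʲ` have small
mass. -/
theorem naturalMeasure_le_of_notMem_badEvent (hM : ∀ n, 2 ≤ M n) (hN : ∀ n, 1 ≤ N n) {t : ℝ}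
    {m : ℕ → ℕ} (hm : ∀ j, side M (m j) ≤ (1 / 2) ^ j) {j : ℕ} (hj : 3 ≤ j) {ω : Sample M N}
    (hω : ω ∉ badEvent M N t m j) {u : Plane} (hu : ‖u‖ = 1) (a : ℝ) {S : Set Plane}
    (hS : MeasurableSet S) (hSu : ∀ y ∈ S, |u 0 * y 0 + u 1 * y 1 - a| ≤ (1 / 2) ^ j) :
    (naturalMeasure ω : Measure Plane) S ≤ ENNReal.ofReal (((1 / 2 : ℝ) ^ j) ^ t) := by
  classical
  set ρ : ℝ := (1 / 2) ^ j with hρ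
  have hρ0 : 0 < ρ := by positivity
  have hρ8 : ρ ≤ 1 / 8 :=
    (pow_le_pow_of_le_one (by norm_num) (by norm_num) hj).trans (by norm_num)
  have husq : u 0 ^ 2 + u 1 ^ 2 = 1 := by
    have := EuclideanSpace.norm_sq_eq u
    rw [hu, Fin.sum_univ_two, Real.norm_eq_abs, Real.norm_eq_abs, sq_abs, sq_abs] at this
    linarith
  have hu01 : |u 0| ≤ 1 := abs_le_one_iff_mul_self_le_one.2 (by nlinarith [sq_nonneg (u 1)])
  have hu11 : |u 1| ≤ 1 := abs_le_one_iff_mul_self_le_one.2 (by nlinarith [sq_nonneg (u 0)])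
  have hu0' := abs_le.1 hu01
  have hu1' := abs_le.1 hu11
  have hmem : ∀ v, ∀ y ∈ square ω (m j) v, ∀ c, 0 ≤ corner ω (m j) v c ∧
      corner ω (m j) v c ≤ 1 ∧ 0 ≤ y c - corner ω (m j) v c ∧ y c - corner ω (m j) v c ≤ ρ ∧
      y c ≤ 1 := fun v y hy c => by
    have h1 := hy c
    rw [Set.mem_Icc] at h1
    have h2 := corner_add_side_le hM ω (m j) v c
    have h3 := side_pos hM (m j)
    refine ⟨corner_nonneg hM ω _ v c, ?_, ?_, ?_, ?_⟩ <;> linarith [hm j]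
  -- On the unit square `|⟨u, y⟩| ≤ 2`, so for `|a| > 3` the set `S` meets no square; otherwise `a`
  -- is in the range of the net.
  by_cases ha : 3 < |a|
  · refine (naturalMeasure_le hM hN ω (m j) hS ∅ fun v y hy hyS => ?_).trans (by simp)
    exfalso
    have h0 := hmem v y hy 0
    have h1 := hmem v y hy 1
    have h2 := hSu y hyS
    have hy0 : |u 0 * y 0| ≤ 1 := by
      rw [abs_mul]
      exact mul_le_one₀ hu01 (abs_nonneg _) (abs_le.2 ⟨by linarith, by linarith⟩)
    have hy1 : |u 1 * y 1| ≤ 1 := by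
      rw [abs_mul]
      exact mul_le_one₀ hu11 (abs_nonneg _) (abs_le.2 ⟨by linarith, by linarith⟩)
    rw [abs_le] at h2 hy0 hy1
    rcases lt_abs.1 ha with h | h <;> linarith
  · set k : ℤ × ℤ × ℤ := (⌊u 0 / ρ⌋, ⌊u 1 / ρ⌋, ⌊a / ρ⌋) with hk
    have hb0 := mul_floor_div_bounds hρ0 (u 0)
    have hb1 := mul_floor_div_bounds hρ0 (u 1)
    have hba := mul_floor_div_bounds hρ0 a
    have hkmem : k ∈ (netIndex j).filter fun k => ∃ b, 1 / 2 ≤ |netVector ρ k b| := by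
      refine Finset.mem_filter.2 ⟨?_, ?_⟩
      · exact Finset.mem_product.2 ⟨floor_mem_Icc hu01 (by norm_num), Finset.mem_product.2
          ⟨floor_mem_Icc hu11 (by norm_num), floor_mem_Icc (not_lt.1 ha) le_rfl⟩⟩
      -- Rounding moves each coordinate by at most `1/8`. If both rounded coordinates were below
      -- `1/2` in absolute value, then `‖u‖² ≤ 2 * (5/8)² < 1`.
      · by_contra! hcon
        have h0 := abs_lt.1 (hcon 0)
        have h1 := abs_lt.1 (hcon 1)
        simp only [netVector, hk, Matrix.cons_val_zero, Matrix.cons_val_one] at h0 h1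
        have h2 : |u 0| ≤ 5 / 8 := abs_le.2 ⟨by linarith, by linarith⟩
        have h3 : |u 1| ≤ 5 / 8 := abs_le.2 ⟨by linarith, by linarith⟩
        have h4 := pow_le_pow_left₀ (abs_nonneg _) h2 2
        have h5 := pow_le_pow_left₀ (abs_nonneg _) h3 2
        rw [sq_abs] at h4 h5
        linarith
    have hnot : ω ∉ {ω : Sample M N | ρ ^ t ≤ cornerMean
        ((strip (netVector ρ k) (ρ * k.2.2) (6 * ρ)).indicator 1) (m j) ω} := fun h =>
      hω (Set.mem_biUnion hkmem h)
    refine (naturalMeasure_le hM hN ω (m j) hS (strip (netVector ρ k) (ρ * k.2.2) (6 * ρ))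
      fun v y hy hyS => ?_).trans (ENNReal.ofReal_le_ofReal (not_le.1 hnot).le)
    obtain ⟨p0, p0', d0, d0', -⟩ := hmem v y hy 0
    obtain ⟨p1, p1', d1, d1', -⟩ := hmem v y hy 1
    set p := corner ω (m j) v
    have h2 := abs_le.1 (hSu y hyS)
    have e0 : |u 0 * (y 0 - p 0)| ≤ ρ := by
      rw [abs_mul, abs_of_nonneg d0]
      nlinarith [abs_nonneg (u 0)]
    have e1 : |u 1 * (y 1 - p 1)| ≤ ρ := by
      rw [abs_mul, abs_of_nonneg d1]
      nlinarith [abs_nonneg (u 1)]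
    have e2 : |(u 0 - ρ * ⌊u 0 / ρ⌋) * p 0| ≤ ρ := by
      rw [abs_of_nonneg (mul_nonneg hb0.1 p0)]
      nlinarith
    have e3 : |(u 1 - ρ * ⌊u 1 / ρ⌋) * p 1| ≤ ρ := by
      rw [abs_of_nonneg (mul_nonneg hb1.1 p1)]
      nlinarith
    rw [abs_le] at e0 e1 e2 e3
    -- The factor `6` is one `ρ` from `S`, two from replacing `y` by the corner, two from rounding
    -- `u` and one from rounding `a`.
    change |ρ * ⌊u 0 / ρ⌋ * p 0 + ρ * ⌊u 1 / ρ⌋ * p 1 - ρ * ⌊a / ρ⌋| ≤ 6 * ρ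
    rw [abs_le]
    constructor <;> linarith

end RandomCantor

/-! ### Conclusion: from dyadic scales to all radii. -/

theorem theorem2p3 (M N : ℕ → ℕ) (hM : ∀ n, 2 ≤ M n) (hN : ∀ n, 1 ≤ N n)
    (hNM : ∀ n, N n ≤ M n ^ 2) (hs : RandomCantor.dimension M N < 1)
    (t : ℝ) (ht0 : 0 ≤ t) (hts : t < RandomCantor.dimension M N) :
    (∀ ω : RandomCantor.Sample M N,
      IsProbabilityMeasure (RandomCantor.naturalMeasure ω : Measure RandomCantor.Plane) ∧
      Tendsto (fun n => RandomCantor.levelMeasure ω n) atTop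
        (𝓝 (RandomCantor.naturalMeasure ω))) ∧
    ∃ C₀ : ℝ, ∃ A : Set (RandomCantor.Sample M N),
      MeasurableSet A ∧ 0 < RandomCantor.law M N A ∧
      ∀ ω ∈ A, ∀ (ℓ : AffineSubspace ℝ RandomCantor.Plane) [Nonempty ℓ],
        Module.finrank ℝ ℓ.direction = 1 → ∀ (x : ℓ) (r : ℝ), 0 < r →
          Measure.map (EuclideanGeometry.orthogonalProjection ℓ)
            (RandomCantor.naturalMeasure ω : Measure RandomCantor.Plane) (Metric.ball x r)
              ≤ ENNReal.ofReal (C₀ * r ^ t) := by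
  have hprob : ∀ ω : RandomCantor.Sample M N,
      IsProbabilityMeasure (RandomCantor.naturalMeasure ω : Measure RandomCantor.Plane) := by
    intro ω
    have := RandomCantor.isProbabilityMeasure_branchMeasure hN
    rw [(RandomCantor.naturalMeasure_eq hM hN ω).1]
    exact Measure.isProbabilityMeasure_map (RandomCantor.measurable_limitPoint hM ω).aemeasurable
  refine ⟨fun ω => ⟨hprob ω, (RandomCantor.naturalMeasure_eq hM hN ω).2⟩, ?_⟩
  have := RandomCantor.isProbabilityMeasure_law (N := N) hM
  choose m hm using fun j : ℕ =>
    RandomCantor.exists_side_le hM (by positivity : (0 : ℝ) < (1 / 2) ^ j)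
  obtain ⟨j₀, hj₀, hlt⟩ := RandomCantor.exists_law_iUnion_badEvent_lt_one hM hN ht0
    (hts.trans hs) hts hm
  have hmeas : MeasurableSet (⋃ j, RandomCantor.badEvent M N t m (j + j₀)) :=
    MeasurableSet.iUnion fun j => RandomCantor.measurableSet_badEvent hM t m _
  -- With this constant the bound is at least `1`, hence trivial, for `r ≥ 2^(-j₀)`. For smaller
  -- `r`, with `2^(-j-1) < r ≤ 2^(-j)`, the mass is at most `2^(-j t) ≤ (2 r) ^ t`, and `2 ≤ 2 ^
  -- j₀`.
  refine ⟨(2 ^ j₀) ^ t, _, hmeas.compl, ?_, fun ω hω ℓ _ hℓ x r hr => ?_⟩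
  · rw [prob_compl_eq_one_sub hmeas]
    exact tsub_pos_of_lt hlt
  have := hprob ω
  have hproj : Measurable (EuclideanGeometry.orthogonalProjection ℓ) :=
    (EuclideanGeometry.orthogonalProjection ℓ).continuous.measurable
  have hpow : (1 / 2 : ℝ) ^ j₀ * 2 ^ j₀ = 1 := by rw [← mul_pow]; norm_num
  have h2j : (2 : ℝ) ≤ 2 ^ j₀ := le_self_pow₀ one_le_two (by omega)
  rw [Measure.map_apply hproj Metric.isOpen_ball.measurableSet,
    ← Real.mul_rpow (by positivity) hr.le]
  rcases le_or_gt ((1 / 2 : ℝ) ^ j₀) r with hr' | hr'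
  · refine prob_le_one.trans ?_
    rw [ENNReal.one_le_ofReal]
    exact Real.one_le_rpow (by nlinarith) ht0
  obtain ⟨j, hj, hj'⟩ := exists_nat_pow_near_of_lt_one hr
    (hr'.le.trans (pow_le_one₀ (by norm_num) (by norm_num))) (by norm_num : (0 : ℝ) < 1 / 2)
    (by norm_num)
  have hjj : j₀ ≤ j := by
    by_contra hcon
    have := pow_le_pow_of_le_one (by norm_num : (0 : ℝ) ≤ 1 / 2) (by norm_num)
      (by omega : j + 1 ≤ j₀)
    linarith
  obtain ⟨i, rfl⟩ := Nat.exists_eq_add_of_le' hjj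
  obtain ⟨u, hu, hu1⟩ := RandomCantor.exists_unit_vector ℓ hℓ
  refine (RandomCantor.naturalMeasure_le_of_notMem_badEvent hM hN hm (by omega)
    (fun h => hω (Set.mem_iUnion.2 ⟨i, h⟩)) hu1 _ (hproj Metric.isOpen_ball.measurableSet)
    fun y hy => (RandomCantor.abs_lt_of_mem_preimage_ball ℓ hu hu1 hy).le.trans hj').trans ?_
  refine ENNReal.ofReal_le_ofReal (Real.rpow_le_rpow (by positivity) ?_ ht0)
  rw [pow_succ] at hj
  nlinarith
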